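/- Let $d\ge 1$. For $X^{(1)},\dots,X^{(m+1)}\in\mathbb R^m$ let \[ o_m(X^{(1)},\dots,X^{(m+1)})=\operatorname{sgn}\det\big(X^{(i+1)}_j-X^{(1)}_j\big)_{i,j=1}^m\in\{-1,0,1\} \] (with $o_0=1$), and for $x\in\mathbb R^d$ let $x'=(x_1,\dots,x_{d-1})\in\mathbb R^{d-1}$ be its projection. For a polytope $\omega\subset\mathbb R^d$ put \[ \chi_\omega(x)=\lim_{\rho\to0^+}\frac{|\omega\cap B_\rho(x)|}{|B_\rho(x)|}. \] For affinely independent points $X^{(1)},\dots,X^{(d)}\in\mathbb R^d$ define the characteristic function $\chi_P$ of the generalized truncated prism $P=P(X^{(1)},\dots,X^{(d)})$ as follows. If the hyperplane through $X^{(1)},\dots,X^{(d)}$ is perpendicular to the hyperplane $\{x_d=0\}$ (i.e. parallel to $e_d$), then $\chi_P:=0$. Otherwise let $x_d=h(x')$, with $h$ affine, be its equation, and put \[ \tilde\chi_P(x)=\begin{cases}1,& 0<x_d<h(x')\text{ and }x'\in\operatorname{conv}((X^{(1)})',\dots,(X^{(d)})'),\\ -1,& h(x')<x_d<0\text{ and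 }x'\in\operatorname{conv}((X^{(1)})',\dots,(X^{(d)})'),\\ 0,&\text{otherwise,}\end{cases} \qquad \chi_P(x)=\lim_{\rho\to0^+}\frac1{|B_\rho(x)|}\int_{B_\rho(x)}\tilde\chi_P(\xi)\,d\xi . \] Let $A^{(1)},\dots,A^{(d+1)}\in\mathbb R^d$ satisfy $o_d(A^{(1)},\dots,A^{(d+1)})=1$, let $T=\operatorname{conv}(A^{(1)},\dots,A^{(d+1)})$, and for $k=1,\dots,d+1$ let \[ P^{(k)}=P(A^{(1)},\dots,A^{(k-1)},A^{(k+1)},\dots,A^{(d+1)}),\qquad o^{(k)}=o_{d-1}\big((A^{(1)})',\dots,(A^{(k-1)})',(A^{(k+1)})',\dots,(A^{(d+1)})'\big). \] Then the limits defining $\chi_T$ and $\chi_{P^{(k)}}$ exist at every point (and the functions $\tilde\chi_{P^{(k)}}$ are integrable), and \[ \chi_T(x)=(-1)^d\sum_{k=1}^{d+1}(-1)^k\,o^{(k)}\,\chi_{P^{(k)}}(x)\qquad\text{for every }x\in\mathbb R^d . \] In particular, for odd $d$ (such as $d=3$) one has $\chi_T=-\sum_{k=1}^{d+1}(-1)^k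 o^{(k)}\chi_{P^{(k)}}$. -/

import Mathlib

open MeasureTheory Filter Topology

noncomputable section

namespace PrismSplitting

/-- Orientation `o_d(X⁽¹⁾, …, X⁽ᵈ⁺¹⁾) ∈ {-1, 0, 1}` of `d + 1` points of `ℝᵈ`: the sign of the
determinant with rows `X⁽ⁱ⁺¹⁾ - X⁽¹⁾`. For `d = 0` the determinant is empty and the value is `1`. -/
def orient {d : ℕ} (X : Fin (d + 1) → EuclideanSpace ℝ (Fin d)) : SignType :=
  SignType.sign (Matrix.det (Matrix.of fun i j : Fin d => X i.succ j - X 0 j))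

/-- Projection of `ℝⁿ⁺¹` to the hyperplane where the last coordinate vanishes, this hyperplane being
identified with `ℝⁿ`. -/
def proj {n : ℕ} (x : EuclideanSpace ℝ (Fin (n + 1))) : EuclideanSpace ℝ (Fin n) :=
  WithLp.toLp 2 fun i => x i.castSucc

/-- The quotient `|ω ∩ B_ρ(x)| / |B_ρ(x)|`. -/
def densityRatio {d : ℕ} (ω : Set (EuclideanSpace ℝ (Fin d))) (x : EuclideanSpace ℝ (Fin d))
    (ρ : ℝ) : ℝ :=
  volume.real (ω ∩ Metric.ball x ρ) / volume.real (Metric.ball x ρ)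

/-- The density-type characteristic function `χ_ω(x) = lim_{ρ → 0} |ω ∩ B_ρ(x)| / |B_ρ(x)|`. -/
def chi {d : ℕ} (ω : Set (EuclideanSpace ℝ (Fin d))) (x : EuclideanSpace ℝ (Fin d)) : ℝ :=
  limUnder (𝓝[>] (0 : ℝ)) (densityRatio ω x)

/-- The plane through the points `X⁽¹⁾, …, X⁽ᵈ⁾` of `ℝᵈ`, `d = n + 1`, is perpendicular to the
hyperplane `x_d = 0`, that is, it is parallel to the last basis vector `e_d`. -/
def IsVertical {n : ℕ} (X : Fin (n + 1) → EuclideanSpace ℝ (Fin (n + 1))) : Prop :=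
  EuclideanSpace.single (Fin.last n) (1 : ℝ) ∈ (affineSpan ℝ (Set.range X)).direction

open Classical in
/-- The affine function `h` on `ℝⁿ` such that `x_d = h(x₁, …, x_{d-1})` is an equation of the plane
through the points `X⁽¹⁾, …, X⁽ᵈ⁾` of `ℝᵈ`, `d = n + 1`. For affinely independent points that span a
non-vertical plane there is exactly one such function; otherwise this is a dummy value. -/
def planeHeight {n : ℕ} (X : Fin (n + 1) → EuclideanSpace ℝ (Fin (n + 1))) :
    EuclideanSpace ℝ (Fin n) →ᵃ[ℝ] ℝ :=
  if H : ∃ h : EuclideanSpace ℝ (Fin n) →ᵃ[ℝ] ℝ, ∀ i, h (proj (X i)) = X i (Fin.last n) then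
    H.choose
  else 0

open Classical in
/-- The signed indicator of the truncated prism between the hyperplane `x_d = 0` and the face with
vertices `X⁽¹⁾, …, X⁽ᵈ⁾`: it is `1` below the face and above the hyperplane, `-1` above the face and
below the hyperplane, and `0` elsewhere. -/
def prismIndicator {n : ℕ} (X : Fin (n + 1) → EuclideanSpace ℝ (Fin (n + 1)))
    (x : EuclideanSpace ℝ (Fin (n + 1))) : ℝ :=
  if proj x ∈ convexHull ℝ (Set.range fun i => proj (X i)) ∧
      0 < x (Fin.last n) ∧ x (Fin.last n) < planeHeight X (proj x) then 1
  else if proj x ∈ convexHull ℝ (Set.range fun i => proj (X i)) ∧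
      x (Fin.last n) < 0 ∧ planeHeight X (proj x) < x (Fin.last n) then -1
  else 0

/-- The mean value of the signed prism indicator over the ball `B_ρ(x)`. -/
def prismMean {n : ℕ} (X : Fin (n + 1) → EuclideanSpace ℝ (Fin (n + 1)))
    (x : EuclideanSpace ℝ (Fin (n + 1))) (ρ : ℝ) : ℝ :=
  (∫ ξ in Metric.ball x ρ, prismIndicator X ξ) / volume.real (Metric.ball x ρ)

open Classical in
/-- The characteristic function `χ_P` of the generalized truncated prism `P(X⁽¹⁾, …, X⁽ᵈ⁾)`. -/
def prismChi {n : ℕ} (X : Fin (n + 1) → EuclideanSpace ℝ (Fin (n + 1)))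
    (x : EuclideanSpace ℝ (Fin (n + 1))) : ℝ :=
  if IsVertical X then 0 else limUnder (𝓝[>] (0 : ℝ)) (prismMean X x)

/-- The vertices `A⁽¹⁾, …, A⁽ᵏ⁻¹⁾, A⁽ᵏ⁺¹⁾, …, A⁽ᵈ⁺¹⁾` of the face opposite to `A⁽ᵏ⁾`, in order. -/
def face {n : ℕ} (A : Fin (n + 2) → EuclideanSpace ℝ (Fin (n + 1))) (k : Fin (n + 2)) :
    Fin (n + 1) → EuclideanSpace ℝ (Fin (n + 1)) :=
  fun i => A (k.succAbove i)

end PrismSplitting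

end

/-! Follow the vertical line through a generic point `x`. The barycentric coordinates are affine
along it, `l i + s * m i` with `∑ i, m i = 0`, so the line meets the simplex either not at all or in
a segment entered through a facet with `0 < m p` and left through one with `m q < 0`. By Cramer's
rule (`sign_vert`) the sign of `m k` is the orientation of the projected facet `k` times a power of
`-1`. If the line hits facet `k` at parameter `t k`, the signed prism indicator at `x` is `[0 < t k]
- [x_d < 0]` (`prismIndicator_face`). In the signed sum the second bracket cancels between `p` and
`q`, leaving `[0 < t p] - [0 < t q]`, which is minus the indicator of the simplex
(`sum_sign_hit_eq`). Genericity fails only on a null set, so averaging over balls gives an identity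
at every point. The limits exist because a convex set has a density everywhere and a prism indicator
is a difference of two convex indicators. -/

namespace PrismSplitting

/-! ### Densities of convex sets -/

/-- The density ratio of a convex set at one of its points decreases with the radius. -/
lemma antitoneOn_densityRatio {d : ℕ} {C : Set (EuclideanSpace ℝ (Fin d))} (hC : Convex ℝ C)
    {x : EuclideanSpace ℝ (Fin d)} (hx : x ∈ C) : AntitoneOn (densityRatio C x) (Set.Ioi 0) := by
  intro r hr s hs hrs
  rw [Set.mem_Ioi] at hr hs
  have hc : 0 < r / s := div_pos hr hs
  have hc1 : r / s ≤ 1 := (div_le_one hs).2 hrs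
  have hscale (S : Set (EuclideanSpace ℝ (Fin d))) :
      volume.real (AffineMap.homothety x (r / s) '' S) = (r / s) ^ d * volume.real S := by
    rw [measureReal_def, Measure.addHaar_image_homothety, ENNReal.toReal_mul,
      ENNReal.toReal_ofReal (abs_nonneg _), finrank_euclideanSpace_fin, abs_of_pos (pow_pos hc d),
      measureReal_def]
  have hball : volume.real (Metric.ball x r) = (r / s) ^ d * volume.real (Metric.ball x s) := by
    have h := Measure.addHaar_ball_mul_of_pos (volume : Measure (EuclideanSpace ℝ (Fin d))) x hc s
    rw [div_mul_cancel₀ _ hs.ne', finrank_euclideanSpace_fin,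
      ← Measure.addHaar_ball_center volume x s] at h
    rw [measureReal_def, h, ENNReal.toReal_mul, ENNReal.toReal_ofReal (pow_pos hc d).le,
      measureReal_def]
  -- Shrinking towards `x ∈ C` keeps a convex set inside itself and scales all volumes by the same
  -- factor as the balls.
  have hsub : AffineMap.homothety x (r / s) '' (C ∩ Metric.ball x s) ⊆ C ∩ Metric.ball x r := by
    rintro _ ⟨y, ⟨hyC, hy⟩, rfl⟩
    refine ⟨?_, ?_⟩
    · rw [AffineMap.homothety_eq_lineMap]
      exact hC.lineMap_mem hx hyC ⟨hc.le, hc1⟩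
    · rw [Metric.mem_ball] at hy ⊢
      rw [dist_homothety_center, Real.norm_of_nonneg hc.le, dist_comm]
      calc r / s * dist y x < r / s * s := by gcongr
        _ = r := div_mul_cancel₀ _ hs.ne'
  have hmono : (r / s) ^ d * volume.real (C ∩ Metric.ball x s) ≤
      volume.real (C ∩ Metric.ball x r) := by
    rw [← hscale]
    exact measureReal_mono hsub
      (ne_top_of_le_ne_top measure_ball_lt_top.ne (measure_mono Set.inter_subset_right))
  rw [densityRatio, densityRatio, hball, ← mul_div_mul_left _ _ (pow_pos hc d).ne']
  gcongr

lemma densityRatio_le_one {d : ℕ} (C : Set (EuclideanSpace ℝ (Fin d)))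
    (x : EuclideanSpace ℝ (Fin d)) (ρ : ℝ) : densityRatio C x ρ ≤ 1 :=
  div_le_one_of_le₀ (measureReal_mono Set.inter_subset_right measure_ball_lt_top.ne)
    measureReal_nonneg

lemma densityRatio_congr {d : ℕ} {C D : Set (EuclideanSpace ℝ (Fin d))} (h : C =ᵐ[volume] D)
    (x : EuclideanSpace ℝ (Fin d)) : densityRatio C x = densityRatio D x := by
  ext ρ
  have h' : (C ∩ Metric.ball x ρ : Set _) =ᵐ[volume] (D ∩ Metric.ball x ρ : Set _) :=
    h.inter (ae_eq_refl _)
  rw [densityRatio, densityRatio, measureReal_congr h']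

/-- A convex set has a density at every point. -/
lemma exists_tendsto_densityRatio {d : ℕ} {C : Set (EuclideanSpace ℝ (Fin d))} (hC : Convex ℝ C)
    (x : EuclideanSpace ℝ (Fin d)) : ∃ L, Tendsto (densityRatio C x) (𝓝[>] (0 : ℝ)) (𝓝 L) := by
  -- The frontier is null, so `C` may be replaced by its closure: then `x` is either in the set,
  -- where monotonicity applies, or at positive distance from it.
  have hcl : C =ᵐ[volume] closure C :=
    (subset_closure.eventuallyLE).antisymm (ae_le_set.2 (measure_mono_null
      (show closure C \ C ⊆ frontier C from fun y hy =>
        ⟨hy.1, fun hi => hy.2 (interior_subset hi)⟩) (hC.addHaar_frontier volume)))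
  rw [densityRatio_congr hcl]
  by_cases hx : x ∈ closure C
  · exact ⟨_, (antitoneOn_densityRatio hC.closure hx).tendsto_nhdsGT
      ⟨1, by rintro _ ⟨ρ, -, rfl⟩; exact densityRatio_le_one _ _ _⟩⟩
  · refine ⟨0, tendsto_const_nhds.congr' ?_⟩
    obtain ⟨ε, hε, hball⟩ := Metric.isOpen_iff.1 isClosed_closure.isOpen_compl x hx
    filter_upwards [Ioo_mem_nhdsGT hε] with ρ hρ
    have : closure C ∩ Metric.ball x ρ = ∅ := Set.eq_empty_iff_forall_notMem.2 fun y hy =>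
      hball (Metric.ball_subset_ball hρ.2.le hy.2) hy.1
    simp [densityRatio, this]

/-! ### Prisms as differences of convex sets -/

lemma continuous_proj {n : ℕ} : Continuous (proj (n := n)) := by
  unfold proj
  fun_prop

lemma proj_combo {n : ℕ} (a b : ℝ) (x y : EuclideanSpace ℝ (Fin (n + 1))) :
    proj (a • x + b • y) = a • proj x + b • proj y := by
  ext i
  simp [proj]

/-- The part of the generalized truncated prism above the hyperplane. -/
def prismUpper {n : ℕ} (X : Fin (n + 1) → EuclideanSpace ℝ (Fin (n + 1))) :
    Set (EuclideanSpace ℝ (Fin (n + 1))) :=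
  {x | proj x ∈ convexHull ℝ (Set.range fun i => proj (X i)) ∧
      0 < x (Fin.last n) ∧ x (Fin.last n) < planeHeight X (proj x)}

/-- The part of the generalized truncated prism below the hyperplane. -/
def prismLower {n : ℕ} (X : Fin (n + 1) → EuclideanSpace ℝ (Fin (n + 1))) :
    Set (EuclideanSpace ℝ (Fin (n + 1))) :=
  {x | proj x ∈ convexHull ℝ (Set.range fun i => proj (X i)) ∧
      x (Fin.last n) < 0 ∧ planeHeight X (proj x) < x (Fin.last n)}

lemma affineMap_combo {E : Type*} [AddCommGroup E] [Module ℝ E] (h : E →ᵃ[ℝ] ℝ) {a b : ℝ}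
    (hab : a + b = 1) (x y : E) : h (a • x + b • y) = a * h x + b * h y := by
  have := Convex.combo_affine_apply (f := h) (x := x) (y := y) hab
  simpa using this

lemma convex_prismUpper {n : ℕ} (X : Fin (n + 1) → EuclideanSpace ℝ (Fin (n + 1))) :
    Convex ℝ (prismUpper X) := by
  rintro x ⟨hx, hx0, hxh⟩ y ⟨hy, hy0, hyh⟩ a b ha hb hab
  refine ⟨?_, ?_, ?_⟩
  · rw [proj_combo]
    exact convex_convexHull ℝ _ hx hy ha hb hab
  · simpa using (convex_Ioi (0 : ℝ)) hx0 hy0 ha hb hab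
  · rw [proj_combo, affineMap_combo _ hab]
    have := (convex_Ioi (0 : ℝ)) (sub_pos.2 hxh) (sub_pos.2 hyh) ha hb hab
    simp only [smul_eq_mul, Set.mem_Ioi, PiLp.add_apply, PiLp.smul_apply] at this ⊢
    linarith

lemma convex_prismLower {n : ℕ} (X : Fin (n + 1) → EuclideanSpace ℝ (Fin (n + 1))) :
    Convex ℝ (prismLower X) := by
  rintro x ⟨hx, hx0, hxh⟩ y ⟨hy, hy0, hyh⟩ a b ha hb hab
  refine ⟨?_, ?_, ?_⟩
  · rw [proj_combo]
    exact convex_convexHull ℝ _ hx hy ha hb hab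
  · simpa using (convex_Iio (0 : ℝ)) hx0 hy0 ha hb hab
  · rw [proj_combo, affineMap_combo _ hab]
    have := (convex_Ioi (0 : ℝ)) (sub_pos.2 hxh) (sub_pos.2 hyh) ha hb hab
    simp only [smul_eq_mul, Set.mem_Ioi, PiLp.add_apply, PiLp.smul_apply] at this ⊢
    linarith

lemma prismIndicator_eq {n : ℕ} (X : Fin (n + 1) → EuclideanSpace ℝ (Fin (n + 1))) :
    prismIndicator X = fun x => (prismUpper X).indicator (fun _ => (1 : ℝ)) x -
      (prismLower X).indicator (fun _ => (1 : ℝ)) x := by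
  ext x
  by_cases hu : x ∈ prismUpper X
  · have hl : x ∉ prismLower X := fun hl => lt_asymm hu.2.1 hl.2.1
    rw [Set.indicator_of_mem hu, Set.indicator_of_notMem hl]
    exact (if_pos hu).trans (sub_zero _).symm
  · rw [Set.indicator_of_notMem hu]
    by_cases hl : x ∈ prismLower X
    · rw [Set.indicator_of_mem hl, zero_sub]
      exact (if_neg hu).trans (if_pos hl)
    · rw [Set.indicator_of_notMem hl, sub_zero]
      exact (if_neg hu).trans (if_neg hl)

/-- The projection of a prism is covered by a compact set, and its last coordinate is bounded. -/
lemma volume_prism_ne_top {n : ℕ} (X : Fin (n + 1) → EuclideanSpace ℝ (Fin (n + 1)))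
    {S : Set (EuclideanSpace ℝ (Fin (n + 1)))}
    (hS : ∀ x ∈ S, proj x ∈ convexHull ℝ (Set.range fun i => proj (X i)) ∧
      |x (Fin.last n)| ≤ |planeHeight X (proj x)|) : volume S ≠ ⊤ := by
  have hK : IsCompact (convexHull ℝ (Set.range fun i => proj (X i))) :=
    (Set.finite_range _).isCompact_convexHull ℝ
  obtain ⟨R, hR⟩ := hK.isBounded.exists_norm_le
  obtain ⟨H, hH⟩ := hK.exists_bound_of_continuousOn
    (planeHeight X).continuous_of_finiteDimensional.continuousOn
  have hB : Bornology.IsBounded S := by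
    refine isBounded_iff_forall_norm_le.2 ⟨R + H, fun x hx => ?_⟩
    have h1 := hR _ (hS x hx).1
    have h2 := (hS x hx).2.trans (hH _ (hS x hx).1)
    have h3 : ‖x‖ ^ 2 = ‖proj x‖ ^ 2 + |x (Fin.last n)| ^ 2 := by
      rw [EuclideanSpace.real_norm_sq_eq, EuclideanSpace.real_norm_sq_eq, Fin.sum_univ_castSucc,
        sq_abs]
      rfl
    have h4 := norm_nonneg (proj x)
    have h5 := abs_nonneg (x (Fin.last n))
    calc ‖x‖ ≤ ‖proj x‖ + |x (Fin.last n)| :=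
          abs_le_of_sq_le_sq' (by nlinarith) (by positivity) |>.2
      _ ≤ R + H := add_le_add h1 h2
  exact hB.measure_lt_top.ne

lemma measurableSet_prismUpper {n : ℕ} (X : Fin (n + 1) → EuclideanSpace ℝ (Fin (n + 1))) :
    MeasurableSet (prismUpper X) := by
  have hK : IsClosed (convexHull ℝ (Set.range fun i => proj (X i))) :=
    (Set.finite_range _).isClosed_convexHull ℝ
  have hc : Continuous fun x : EuclideanSpace ℝ (Fin (n + 1)) => x (Fin.last n) := by fun_prop
  have hh : Continuous fun x => planeHeight X (proj x) :=
    (planeHeight X).continuous_of_finiteDimensional.comp continuous_proj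
  exact (hK.preimage continuous_proj).measurableSet.inter
    ((isOpen_lt continuous_const hc).measurableSet.inter (isOpen_lt hc hh).measurableSet)

lemma measurableSet_prismLower {n : ℕ} (X : Fin (n + 1) → EuclideanSpace ℝ (Fin (n + 1))) :
    MeasurableSet (prismLower X) := by
  have hK : IsClosed (convexHull ℝ (Set.range fun i => proj (X i))) :=
    (Set.finite_range _).isClosed_convexHull ℝ
  have hc : Continuous fun x : EuclideanSpace ℝ (Fin (n + 1)) => x (Fin.last n) := by fun_prop
  have hh : Continuous fun x => planeHeight X (proj x) :=
    (planeHeight X).continuous_of_finiteDimensional.comp continuous_proj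
  exact (hK.preimage continuous_proj).measurableSet.inter
    ((isOpen_lt hc continuous_const).measurableSet.inter (isOpen_lt hh hc).measurableSet)

lemma integrable_indicator_prismUpper {n : ℕ}
    (X : Fin (n + 1) → EuclideanSpace ℝ (Fin (n + 1))) :
    Integrable ((prismUpper X).indicator fun _ => (1 : ℝ)) :=
  (integrable_indicator_iff (measurableSet_prismUpper X)).2 <| integrableOn_const
    (volume_prism_ne_top X fun x hx => ⟨hx.1, by
      rw [abs_of_pos hx.2.1, abs_of_pos (hx.2.1.trans hx.2.2)]; exact hx.2.2.le⟩)

lemma integrable_indicator_prismLower {n : ℕ}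
    (X : Fin (n + 1) → EuclideanSpace ℝ (Fin (n + 1))) :
    Integrable ((prismLower X).indicator fun _ => (1 : ℝ)) :=
  (integrable_indicator_iff (measurableSet_prismLower X)).2 <| integrableOn_const
    (volume_prism_ne_top X fun x hx => ⟨hx.1, by
      rw [abs_of_neg hx.2.1, abs_of_neg (hx.2.2.trans hx.2.1)]; exact neg_le_neg hx.2.2.le⟩)

lemma integrable_prismIndicator {n : ℕ} (X : Fin (n + 1) → EuclideanSpace ℝ (Fin (n + 1))) :
    Integrable (prismIndicator X) := by
  rw [prismIndicator_eq]
  exact (integrable_indicator_prismUpper X).sub (integrable_indicator_prismLower X)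

lemma densityRatio_eq_integral {d : ℕ} {C : Set (EuclideanSpace ℝ (Fin d))}
    (hC : MeasurableSet C) (x : EuclideanSpace ℝ (Fin d)) (ρ : ℝ) :
    densityRatio C x ρ =
      (∫ ξ in Metric.ball x ρ, C.indicator (fun _ => (1 : ℝ)) ξ) /
        volume.real (Metric.ball x ρ) := by
  rw [densityRatio, integral_indicator_const _ hC, measureReal_restrict_apply hC, smul_eq_mul,
    mul_one]

lemma prismMean_eq {n : ℕ} (X : Fin (n + 1) → EuclideanSpace ℝ (Fin (n + 1)))
    (x : EuclideanSpace ℝ (Fin (n + 1))) :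
    prismMean X x = fun ρ => densityRatio (prismUpper X) x ρ - densityRatio (prismLower X) x ρ := by
  ext ρ
  rw [densityRatio_eq_integral (measurableSet_prismUpper X),
    densityRatio_eq_integral (measurableSet_prismLower X), ← sub_div,
    ← integral_sub (integrable_indicator_prismUpper X).integrableOn
      (integrable_indicator_prismLower X).integrableOn, prismMean, prismIndicator_eq]

/-- The mean is a difference of two density ratios of convex sets. Non-verticality serves only to
select the limit branch of `prismChi`. -/
lemma tendsto_prismMean {n : ℕ} (X : Fin (n + 1) → EuclideanSpace ℝ (Fin (n + 1)))
    (x : EuclideanSpace ℝ (Fin (n + 1))) (hX : ¬ IsVertical X) :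
    Tendsto (prismMean X x) (𝓝[>] (0 : ℝ)) (𝓝 (prismChi X x)) := by
  obtain ⟨L, hL⟩ := exists_tendsto_densityRatio (convex_prismUpper X) x
  obtain ⟨M, hM⟩ := exists_tendsto_densityRatio (convex_prismLower X) x
  rw [prismChi, if_neg hX]
  refine tendsto_nhds_limUnder ⟨L - M, ?_⟩
  rw [prismMean_eq]
  exact hL.sub hM

lemma tendsto_densityRatio_chi {d : ℕ} {C : Set (EuclideanSpace ℝ (Fin d))} (hC : Convex ℝ C)
    (x : EuclideanSpace ℝ (Fin d)) : Tendsto (densityRatio C x) (𝓝[>] (0 : ℝ)) (𝓝 (chi C x)) :=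
  tendsto_nhds_limUnder (exists_tendsto_densityRatio hC x)

/-! ### Sign count along a vertical line -/

/-- A vertical line parametrized by `s` satisfies the constraints `0 ≤ l i + s * m i` along a segment
that starts on one facet, with `0 < m p`, and ends on another one, with `m q < 0`. -/
lemma sum_sign_hit_eq {ι : Type*} [Fintype ι] (l m : ι → ℝ) (hsum : ∑ i, m i = 0)
    (hm : ∃ i, m i ≠ 0) (hl : ∀ i, l i ≠ 0)
    (hgen : ∀ i j, i ≠ j → m i ≠ 0 → m j ≠ 0 → l i * m j ≠ l j * m i) (g : ℝ)
    [∀ k, Decidable (∀ i, 0 ≤ l i + -(l k / m k) * m i)] [Decidable (∀ i, 0 ≤ l i)] :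
    ∑ k, (SignType.sign (m k) : ℝ) * (if ∀ i, 0 ≤ l i + -(l k / m k) * m i then
      (if 0 < -(l k / m k) then 1 else 0) - g else 0) = -if ∀ i, 0 ≤ l i then 1 else 0 := by
  classical
  -- A coordinate that is constant and negative along the line makes it miss the simplex, so both
  -- sides vanish.
  by_cases hz : ∃ z, m z = 0 ∧ l z < 0
  · obtain ⟨z, hmz, hlz⟩ := hz
    rw [if_neg fun h => (h z).not_gt hlz, neg_zero]
    refine Finset.sum_eq_zero fun k _ => ?_
    rw [if_neg fun h => (h z).not_gt (by rw [hmz]; linarith), mul_zero]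
  push Not at hz
  -- `t k` is the parameter at which the line crosses the `k`-th facet hyperplane (meaningful when
  -- `m k ≠ 0`).
  obtain ⟨t, ht⟩ : ∃ t : ι → ℝ, ∀ k, -(l k / m k) = t k := ⟨_, fun _ => rfl⟩
  have hlt (i) (hi : m i ≠ 0) : l i = -(t i * m i) := by
    rw [← ht]; field_simp
  have hposi (i) (hi : 0 < m i) (s : ℝ) : 0 ≤ l i + s * m i ↔ t i ≤ s := by
    rw [hlt i hi.ne', neg_add_eq_sub, sub_nonneg, mul_le_mul_iff_left₀ hi]
  have hnegi (i) (hi : m i < 0) (s : ℝ) : 0 ≤ l i + s * m i ↔ s ≤ t i := by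
    rw [hlt i hi.ne, neg_add_eq_sub, sub_nonneg, mul_le_mul_right_of_neg hi]
  have hall (s : ℝ) : (∀ i, 0 ≤ l i + s * m i) ↔
      (∀ i, 0 < m i → t i ≤ s) ∧ ∀ i, m i < 0 → s ≤ t i := by
    refine ⟨fun h => ⟨fun i hi => (hposi i hi s).1 (h i), fun i hi => (hnegi i hi s).1 (h i)⟩,
      fun h i => ?_⟩
    rcases lt_trichotomy (m i) 0 with hi | hi | hi
    · exact (hnegi i hi s).2 (h.2 i hi)
    · rw [hi]; simpa using hz i hi
    · exact (hposi i hi s).2 (h.1 i hi)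
  have hinj (i j) (hij : i ≠ j) (hi : m i ≠ 0) (hj : m j ≠ 0) : t i ≠ t j := fun h => by
    refine hgen i j hij hi hj ?_
    rw [hlt i hi, hlt j hj, h]; ring
  have ht0 (i) (hi : m i ≠ 0) : t i ≠ 0 := fun h => hl i (by rw [hlt i hi, h]; ring)
  obtain ⟨i₀, hi₀⟩ := hm
  obtain ⟨a, -, ha⟩ := Finset.exists_pos_of_sum_zero_of_exists_nonzero m hsum
    ⟨i₀, Finset.mem_univ _, hi₀⟩
  obtain ⟨b, -, hb⟩ := Finset.exists_pos_of_sum_zero_of_exists_nonzero (fun i => -m i)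
    (by rw [Finset.sum_neg_distrib, hsum, neg_zero]) ⟨i₀, Finset.mem_univ _, neg_ne_zero.2 hi₀⟩
  -- The constraints cut out `[t p, t q]`: `p` gives the largest lower bound, `q` the smallest upper
  -- bound.
  obtain ⟨p, hp, hpmax⟩ := Finset.exists_max_image (Finset.univ.filter fun i => 0 < m i) t
    ⟨a, by simpa using ha⟩
  obtain ⟨q, hq, hqmin⟩ := Finset.exists_min_image (Finset.univ.filter fun i => m i < 0) t
    ⟨b, by simpa using hb⟩
  simp only [Finset.mem_filter, Finset.mem_univ, true_and] at hp hpmax hq hqmin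
  have hpq : p ≠ q := by rintro rfl; exact lt_asymm hp hq
  have hall' (s : ℝ) : (∀ i, 0 ≤ l i + s * m i) ↔ t p ≤ s ∧ s ≤ t q := by
    rw [hall]
    exact ⟨fun h => ⟨h.1 p hp, h.2 q hq⟩,
      fun h => ⟨fun i hi => (hpmax i hi).trans h.1, fun i hi => h.2.trans (hqmin i hi)⟩⟩
  have hall0 : (∀ i, 0 ≤ l i) ↔ t p ≤ 0 ∧ 0 ≤ t q := by
    simpa using hall' 0
  simp only [ht, hall', hall0]
  rw [Finset.sum_eq_add p q hpq _ (by simp) (by simp)]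
  · have h1 := ht0 p hp.ne'
    have h2 := ht0 q hq.ne
    rw [sign_pos hp, sign_neg hq]
    simp only [le_refl, true_and, and_true, SignType.coe_one, SignType.coe_neg_one]
    rcases h1.lt_or_gt with h1 | h1 <;> rcases h2.lt_or_gt with h2 | h2 <;>
      by_cases h3 : t p ≤ t q <;>
      simp only [h3, h1, h2, h1.le, h2.le, h1.not_ge, h2.not_ge, h1.not_gt, h2.not_gt, if_true,
        if_false, and_true, and_false] <;> linarith
  -- Crossing parameters are distinct, so no third facet hyperplane is crossed at a point of `[t p,
  -- t q]`.
  · rintro k - ⟨hkp, hkq⟩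
    rcases lt_trichotomy (m k) 0 with hk | hk | hk
    · rw [if_neg, mul_zero]
      exact fun h => hinj k q hkq hk.ne hq.ne (h.2.antisymm (hqmin k hk))
    · rw [hk]; simp
    · rw [if_neg, mul_zero]
      exact fun h => hinj k p hkp hk.ne' hp.ne' ((hpmax k hk).antisymm h.1)

/-! ### Barycentric coordinates and orientation -/

lemma mem_convexHull_range_iff {ι E : Type*} [Fintype ι] [AddCommGroup E] [Module ℝ E]
    (v : ι → E) (x : E) : x ∈ convexHull ℝ (Set.range v) ↔
      ∃ w : ι → ℝ, (∀ i, 0 ≤ w i) ∧ ∑ i, w i = 1 ∧ ∑ i, w i • v i = x := by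
  classical
  constructor
  · rw [convexHull_range_eq_exists_affineCombination]
    rintro ⟨s, w, h0, h1, rfl⟩
    refine ⟨fun i => if i ∈ s then w i else 0, fun i => ?_, ?_, ?_⟩
    · dsimp only
      split_ifs with h
      exacts [h0 i h, le_rfl]
    · rw [Finset.sum_ite_mem, Finset.univ_inter, h1]
    · rw [Finset.affineCombination_eq_linear_combination s v w h1]
      simp only [ite_smul, zero_smul]
      rw [Finset.sum_ite_mem, Finset.univ_inter]
  · rintro ⟨w, h0, h1, h2⟩
    exact mem_convexHull_of_exists_fintype w v h0 h1 (fun i => Set.mem_range_self i) h2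

/-- The matrix with rows `(1, X⁽ⁱ⁾)`. -/
def homog {d : ℕ} (X : Fin (d + 1) → EuclideanSpace ℝ (Fin d)) :
    Matrix (Fin (d + 1)) (Fin (d + 1)) ℝ :=
  Matrix.of fun i => Fin.cons 1 (X i)

/-- Subtract the first row from the others, then expand along the first column. -/
lemma det_homog {d : ℕ} (X : Fin (d + 1) → EuclideanSpace ℝ (Fin d)) :
    (homog X).det = Matrix.det (Matrix.of fun i j : Fin d => X i.succ j - X 0 j) := by
  let B : Matrix (Fin (d + 1)) (Fin (d + 1)) ℝ := Matrix.of
    (Fin.cons (Fin.cons 1 (X 0)) fun i => Fin.cons 0 fun j => X i.succ j - X 0 j)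
  have h : (homog X).det = B.det := by
    refine Matrix.det_eq_of_forall_row_eq_smul_add_const (Fin.cons 0 fun _ => 1) 0 rfl ?_
    intro i j
    refine Fin.cases ?_ (fun i => ?_) i <;> refine Fin.cases ?_ (fun j => ?_) j <;>
      simp [B, homog]
  rw [h, Matrix.det_succ_column_zero, Fin.sum_univ_succ]
  have h0 : ∀ i : Fin d, B i.succ 0 = 0 := fun i => rfl
  simp only [h0, mul_zero, zero_mul, Finset.sum_const_zero, add_zero]
  have h1 : B 0 0 = 1 := rfl
  rw [h1, Fin.val_zero, pow_zero, one_mul, one_mul]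
  rfl

lemma orient_eq_sign_det_homog {d : ℕ} (X : Fin (d + 1) → EuclideanSpace ℝ (Fin d)) :
    orient X = SignType.sign (homog X).det := by
  rw [det_homog]; rfl

lemma vecMul_homog_eq_iff {d : ℕ} (X : Fin (d + 1) → EuclideanSpace ℝ (Fin d))
    (w : Fin (d + 1) → ℝ) (x : EuclideanSpace ℝ (Fin d)) :
    Matrix.vecMul w (homog X) = Fin.cons 1 x ↔ ∑ i, w i = 1 ∧ ∑ i, w i • X i = x := by
  have h0 : Matrix.vecMul w (homog X) 0 = ∑ i, w i := by
    simp [Matrix.vecMul, dotProduct, homog]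
  have hs (j : Fin d) : Matrix.vecMul w (homog X) j.succ = (∑ i, w i • X i) j := by
    simp [Matrix.vecMul, dotProduct, homog]
  constructor
  · intro h
    refine ⟨by rw [← h0, h]; rfl, ?_⟩
    ext j
    rw [← hs, h]; rfl
  · rintro ⟨h1, h2⟩
    ext j
    refine Fin.cases ?_ (fun j => ?_) j
    · rw [h0, h1]; rfl
    · rw [hs, h2]; rfl

/-- Barycentric coordinates of `x` with respect to the points `X`. -/
noncomputable def bary {d : ℕ} (X : Fin (d + 1) → EuclideanSpace ℝ (Fin d)) (x : EuclideanSpace ℝ (Fin d)) :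
    Fin (d + 1) → ℝ :=
  Matrix.vecMul (Fin.cons 1 x) (homog X)⁻¹

lemma bary_eq_iff {d : ℕ} {X : Fin (d + 1) → EuclideanSpace ℝ (Fin d)} (hX : (homog X).det ≠ 0)
    (w : Fin (d + 1) → ℝ) (x : EuclideanSpace ℝ (Fin d)) :
    bary X x = w ↔ ∑ i, w i = 1 ∧ ∑ i, w i • X i = x := by
  rw [← vecMul_homog_eq_iff]
  have hu : IsUnit (homog X).det := hX.isUnit
  constructor
  · rintro rfl
    rw [bary, Matrix.vecMul_vecMul, Matrix.nonsing_inv_mul _ hu, Matrix.vecMul_one]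
  · intro h
    rw [bary, ← h, Matrix.vecMul_vecMul, Matrix.mul_nonsing_inv _ hu, Matrix.vecMul_one]

lemma bary_apply {d : ℕ} (X : Fin (d + 1) → EuclideanSpace ℝ (Fin d))
    (x : EuclideanSpace ℝ (Fin d)) (k : Fin (d + 1)) :
    bary X x k = (homog X)⁻¹ 0 k + ∑ j : Fin d, x j * (homog X)⁻¹ j.succ k := by
  simp [bary, Matrix.vecMul, dotProduct, Fin.sum_univ_succ]

lemma bary_vertex {d : ℕ} {X : Fin (d + 1) → EuclideanSpace ℝ (Fin d)} (hX : (homog X).det ≠ 0)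
    (k : Fin (d + 1)) : bary X (X k) = Pi.single k 1 := by
  rw [bary_eq_iff hX]
  simp [Pi.single_apply]

lemma mem_convexHull_iff_bary {d : ℕ} {X : Fin (d + 1) → EuclideanSpace ℝ (Fin d)}
    (hX : (homog X).det ≠ 0) (x : EuclideanSpace ℝ (Fin d)) :
    x ∈ convexHull ℝ (Set.range X) ↔ ∀ i, 0 ≤ bary X x i := by
  rw [mem_convexHull_range_iff]
  constructor
  · rintro ⟨w, h0, h⟩
    rwa [(bary_eq_iff hX w x).2 h]
  · exact fun h => ⟨_, h, (bary_eq_iff hX _ x).1 rfl⟩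

/-- The rate of change of the barycentric coordinates in the vertical direction. -/
noncomputable def vert {n : ℕ} (A : Fin (n + 2) → EuclideanSpace ℝ (Fin (n + 1))) (k : Fin (n + 2)) : ℝ :=
  (homog A)⁻¹ (Fin.last (n + 1)) k

lemma bary_add_single {n : ℕ} (A : Fin (n + 2) → EuclideanSpace ℝ (Fin (n + 1)))
    (x : EuclideanSpace ℝ (Fin (n + 1))) (t : ℝ) (k : Fin (n + 2)) :
    bary A (x + EuclideanSpace.single (Fin.last n) t) k = bary A x k + t * vert A k := by
  simp [bary_apply, vert, add_mul, Finset.sum_add_distrib, add_assoc]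

lemma sum_vert {n : ℕ} {A : Fin (n + 2) → EuclideanSpace ℝ (Fin (n + 1))}
    (hA : (homog A).det ≠ 0) : ∑ k, vert A k = 0 := by
  have h0 := ((bary_eq_iff hA _ (0 : EuclideanSpace ℝ (Fin (n + 1)))).1 rfl).1
  have h1 := ((bary_eq_iff hA _ (0 + EuclideanSpace.single (Fin.last n) (1 : ℝ))).1 rfl).1
  simp only [bary_add_single, Finset.sum_add_distrib, one_mul, h0] at h1
  linarith

/-- Otherwise `0` and `e_d` would share their barycentric coordinates and coincide. -/
lemma exists_vert_ne_zero {n : ℕ} {A : Fin (n + 2) → EuclideanSpace ℝ (Fin (n + 1))}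
    (hA : (homog A).det ≠ 0) : ∃ k, vert A k ≠ 0 := by
  by_contra! h
  have h0 := ((bary_eq_iff hA _ (0 : EuclideanSpace ℝ (Fin (n + 1)))).1 rfl).2
  have h1 := ((bary_eq_iff hA _ (0 + EuclideanSpace.single (Fin.last n) (1 : ℝ))).1 rfl).2
  simp only [bary_add_single, h, mul_zero, add_zero, h0] at h1
  have := congrArg (fun y : EuclideanSpace ℝ (Fin (n + 1)) => y (Fin.last n)) h1
  simp at this

/-- Cramer's rule: the cofactor deletes row `k`, leaving the opposite face, and the last column,
which is the projection. -/
lemma det_homog_proj_face {n : ℕ} {A : Fin (n + 2) → EuclideanSpace ℝ (Fin (n + 1))}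
    (hA : (homog A).det ≠ 0) (k : Fin (n + 2)) :
    (homog A).det * vert A k =
      (-1) ^ ((k : ℕ) + (n + 1)) * (homog fun i => proj (face A k i)).det := by
  have hsub : (homog A).submatrix k.succAbove (Fin.last (n + 1)).succAbove =
      homog fun i => proj (face A k i) := by
    ext i j
    rw [Matrix.submatrix_apply, Fin.succAbove_last]
    refine Fin.cases ?_ (fun j => ?_) j <;> rfl
  rw [vert, Matrix.inv_def, Matrix.smul_apply, smul_eq_mul, Ring.inverse_eq_inv', ← mul_assoc,
    mul_inv_cancel₀ hA, one_mul, Matrix.adjugate_fin_succ_eq_det_submatrix, hsub, Fin.val_last]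

lemma sign_vert {n : ℕ} {A : Fin (n + 2) → EuclideanSpace ℝ (Fin (n + 1))}
    (hA : 0 < (homog A).det) (k : Fin (n + 2)) :
    (SignType.sign (vert A k) : ℝ) =
      (-1) ^ ((k : ℕ) + (n + 1)) * ((orient fun i => proj (face A k i) : SignType) : ℝ) := by
  have h := congrArg SignType.sign (det_homog_proj_face hA.ne' k)
  rw [sign_mul, sign_mul, sign_pos hA, one_mul, ← orient_eq_sign_det_homog] at h
  rw [h, SignType.coe_mul]
  congr 1
  rcases neg_one_pow_eq_or ℝ ((k : ℕ) + (n + 1)) with h | h <;> simp [h]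

/-! ### Facet planes and their heights -/

lemma exists_planeHeight {n : ℕ} {X : Fin (n + 1) → EuclideanSpace ℝ (Fin (n + 1))}
    (hX : (homog fun i => proj (X i)).det ≠ 0) :
    ∃ h : EuclideanSpace ℝ (Fin n) →ᵃ[ℝ] ℝ, ∀ i, h (proj (X i)) = X i (Fin.last n) := by
  let M := homog fun i => proj (X i)
  let c := Matrix.mulVec M⁻¹ fun i => X i (Fin.last n)
  have hc : Matrix.mulVec M c = fun i => X i (Fin.last n) := by
    rw [Matrix.mulVec_mulVec, Matrix.mul_nonsing_inv _ hX.isUnit, Matrix.one_mulVec]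
  refine ⟨(∑ j : Fin n, c j.succ • (EuclideanSpace.proj j :
    EuclideanSpace ℝ (Fin n) →L[ℝ] ℝ).toLinearMap).toAffineMap + AffineMap.const ℝ _ (c 0),
    fun i => ?_⟩
  rw [← congrFun hc i]
  simp [M, Matrix.mulVec, dotProduct, homog, Fin.sum_univ_succ, mul_comm, add_comm]

lemma planeHeight_proj {n : ℕ} {X : Fin (n + 1) → EuclideanSpace ℝ (Fin (n + 1))}
    (hX : (homog fun i => proj (X i)).det ≠ 0) (i : Fin (n + 1)) :
    planeHeight X (proj (X i)) = X i (Fin.last n) := by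
  rw [planeHeight, dif_pos (exists_planeHeight hX)]
  exact (exists_planeHeight hX).choose_spec i

/-- The affine combination of the vertices lies on the graph of the height function. -/
lemma planeHeight_proj_sum {n : ℕ} {X : Fin (n + 1) → EuclideanSpace ℝ (Fin (n + 1))}
    (hX : (homog fun i => proj (X i)).det ≠ 0) {w : Fin (n + 1) → ℝ} (hw : ∑ i, w i = 1) :
    planeHeight X (∑ i, w i • proj (X i)) = (∑ i, w i • X i) (Fin.last n) := by
  rw [← Finset.affineCombination_eq_linear_combination _ _ w hw, Finset.map_affineCombination _ _ _ hw,
    Finset.affineCombination_eq_linear_combination _ _ w hw]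
  simp [planeHeight_proj hX]

lemma not_isVertical {n : ℕ} {X : Fin (n + 1) → EuclideanSpace ℝ (Fin (n + 1))}
    (hX : (homog fun i => proj (X i)).det ≠ 0) : ¬ IsVertical X := by
  intro hv
  let P : EuclideanSpace ℝ (Fin (n + 1)) →ₗ[ℝ] EuclideanSpace ℝ (Fin n) :=
    { toFun := proj, map_add' := fun x y => by ext; simp [proj],
      map_smul' := fun a x => by ext; simp [proj] }
  -- The linear part of `h(x') - x_d` kills every direction of the plane but takes the value `-1` on
  -- `e_d`.
  let D : EuclideanSpace ℝ (Fin (n + 1)) →ₗ[ℝ] ℝ := (planeHeight X).linear ∘ₗ P -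
    (EuclideanSpace.proj (Fin.last n) : EuclideanSpace ℝ (Fin (n + 1)) →L[ℝ] ℝ).toLinearMap
  have hle : (affineSpan ℝ (Set.range X)).direction ≤ LinearMap.ker D := by
    rw [direction_affineSpan, vectorSpan_def, Submodule.span_le]
    rintro _ ⟨_, ⟨i, rfl⟩, _, ⟨j, rfl⟩, rfl⟩
    have h : (planeHeight X).linear (proj (X i) -ᵥ proj (X j)) = X i (Fin.last n) -
        X j (Fin.last n) := by
      rw [AffineMap.linearMap_vsub, planeHeight_proj hX, planeHeight_proj hX, vsub_eq_sub]
    have h' : P (X i - X j) = proj (X i) -ᵥ proj (X j) := map_sub P _ _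
    change D (X i - X j) = 0
    rw [LinearMap.sub_apply, LinearMap.comp_apply, h', h]
    simp
  have h1 : D (EuclideanSpace.single (Fin.last n) (1 : ℝ)) = 0 := hle hv
  have h2 : P (EuclideanSpace.single (Fin.last n) (1 : ℝ)) = 0 := by
    ext i
    simp [P, proj, Fin.ext_iff, i.2.ne]
  simp [D, h2] at h1

lemma proj_sum_smul {n : ℕ} {ι : Type*} [Fintype ι] (w : ι → ℝ)
    (v : ι → EuclideanSpace ℝ (Fin (n + 1))) :
    proj (∑ i, w i • v i) = ∑ i, w i • proj (v i) := by
  ext j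
  simp [proj]

lemma proj_add_single {n : ℕ} (x : EuclideanSpace ℝ (Fin (n + 1))) (t : ℝ) :
    proj (x + EuclideanSpace.single (Fin.last n) t) = proj x := by
  ext i
  simp [proj, Fin.ext_iff, i.2.ne]

lemma eq_add_single_of_proj_eq {n : ℕ} {x y : EuclideanSpace ℝ (Fin (n + 1))}
    (h : proj y = proj x) :
    y = x + EuclideanSpace.single (Fin.last n) (y (Fin.last n) - x (Fin.last n)) := by
  ext i
  refine Fin.lastCases ?_ (fun i => ?_) i
  · simp
  · have := congrArg (fun z : EuclideanSpace ℝ (Fin n) => z i) h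
    simpa [proj, Fin.ext_iff, i.2.ne] using this

/-- If `x` lies in the vertical strip over a non-vertical facet, the facet is met at the height
where the barycentric coordinate of the opposite vertex vanishes. -/
lemma exists_facet_point {n : ℕ} {A : Fin (n + 2) → EuclideanSpace ℝ (Fin (n + 1))}
    (hA : (homog A).det ≠ 0) {k : Fin (n + 2)} (hk : vert A k ≠ 0)
    {x : EuclideanSpace ℝ (Fin (n + 1))} {w : Fin (n + 1) → ℝ} (hw : ∑ i, w i = 1)
    (hx : ∑ i, w i • proj (face A k i) = proj x) :
    ∑ i, w i • face A k i =
        x + EuclideanSpace.single (Fin.last n) (-(bary A x k / vert A k)) ∧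
      ∀ i, bary A x (k.succAbove i) + -(bary A x k / vert A k) * vert A (k.succAbove i) = w i := by
  obtain ⟨t, ht⟩ : ∃ t : ℝ, ∑ i, w i • face A k i =
      x + EuclideanSpace.single (Fin.last n) t :=
    ⟨_, eq_add_single_of_proj_eq (by rw [proj_sum_smul, hx])⟩
  -- A point of the facet plane has `k`-th coordinate `0`; this determines `t`.
  have hb : bary A (∑ i, w i • face A k i) = k.insertNth 0 w := by
    rw [bary_eq_iff hA]
    simp [Fin.sum_univ_succAbove _ k, hw, face]
  rw [ht] at hb
  have htk : -(bary A x k / vert A k) = t := by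
    have := congrFun hb k
    rw [bary_add_single, Fin.insertNth_apply_same] at this
    field_simp
    linarith
  rw [htk]
  refine ⟨ht, fun i => ?_⟩
  rw [← bary_add_single, hb, Fin.insertNth_apply_succAbove]

lemma proj_mem_convexHull_face_iff {n : ℕ} {A : Fin (n + 2) → EuclideanSpace ℝ (Fin (n + 1))}
    (hA : (homog A).det ≠ 0) {k : Fin (n + 2)} (hk : vert A k ≠ 0)
    (x : EuclideanSpace ℝ (Fin (n + 1))) :
    proj x ∈ convexHull ℝ (Set.range fun i => proj (face A k i)) ↔
      ∀ i, 0 ≤ bary A x i + -(bary A x k / vert A k) * vert A i := by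
  have hkk : bary A x k + -(bary A x k / vert A k) * vert A k = 0 := by
    field_simp
    ring
  rw [mem_convexHull_range_iff]
  constructor
  · rintro ⟨w, h0, h1, h2⟩ i
    rcases Fin.eq_self_or_eq_succAbove k i with rfl | ⟨j, rfl⟩
    · exact hkk.ge
    · rw [(exists_facet_point hA hk h1 h2).2 j]
      exact h0 j
  · intro h
    obtain ⟨t, ht⟩ : ∃ t, -(bary A x k / vert A k) = t := ⟨_, rfl⟩
    rw [ht] at h hkk
    have hy := (bary_eq_iff hA _ (x + EuclideanSpace.single (Fin.last n) t)).1 rfl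
    rw [Fin.sum_univ_succAbove _ k, Fin.sum_univ_succAbove _ k, bary_add_single A x t k, hkk,
      zero_add, zero_smul, zero_add] at hy
    refine ⟨fun i => bary A (x + EuclideanSpace.single (Fin.last n) t) (k.succAbove i),
      fun i => ?_, hy.1, ?_⟩
    · dsimp only
      rw [bary_add_single]
      exact h _
    · rw [← proj_sum_smul, ← proj_add_single x t]
      exact congrArg proj hy.2

/-- Over the facet, `h(x') - x_d` is the crossing parameter, so the value depends only on its sign
and that of `x_d`. Written as a difference, the `x_d` part is the same for every facet. -/
lemma prismIndicator_face {n : ℕ} {A : Fin (n + 2) → EuclideanSpace ℝ (Fin (n + 1))}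
    (hA : (homog A).det ≠ 0) {k : Fin (n + 2)} (hk : vert A k ≠ 0)
    {x : EuclideanSpace ℝ (Fin (n + 1))} (hx : x (Fin.last n) ≠ 0) (hb : bary A x k ≠ 0) :
    prismIndicator (face A k) x =
      if ∀ i, 0 ≤ bary A x i + -(bary A x k / vert A k) * vert A i then
        (if 0 < -(bary A x k / vert A k) then 1 else 0) - (if x (Fin.last n) < 0 then 1 else 0)
      else 0 := by
  classical
  simp only [prismIndicator, ← proj_mem_convexHull_face_iff hA hk]
  by_cases hmem : proj x ∈ convexHull ℝ (Set.range fun i => proj (face A k i))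
  · have hdet : (homog fun i => proj (face A k i)).det ≠ 0 := fun h0 => by
      have := det_homog_proj_face hA k
      rw [h0, mul_zero] at this
      exact mul_ne_zero hA hk this
    obtain ⟨w, h0, h1, h2⟩ := (mem_convexHull_range_iff _ _).1 hmem
    have hh : planeHeight (face A k) (proj x) =
        x (Fin.last n) + -(bary A x k / vert A k) := by
      rw [← h2, planeHeight_proj_sum hdet h1, (exists_facet_point hA hk h1 h2).1]
      simp
    have ht : -(bary A x k / vert A k) ≠ 0 := neg_ne_zero.2 (div_ne_zero hb hk)
    simp only [hh, hmem, true_and, if_true, lt_add_iff_pos_right, add_lt_iff_neg_left]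
    rcases hx.lt_or_gt with hx | hx <;> rcases ht.lt_or_gt with ht | ht <;>
      simp [hx, ht, hx.not_gt, ht.not_gt, -Left.neg_pos_iff, -Left.neg_neg_iff]
  · simp only [hmem, false_and, if_false]

/-! ### Null exceptional sets and the identity almost everywhere -/

lemma ae_affine_ne_zero {d : ℕ} (c : ℝ) (a : Fin d → ℝ) {y : EuclideanSpace ℝ (Fin d)}
    (hy : c + ∑ j, y j * a j ≠ 0) :
    ∀ᵐ x : EuclideanSpace ℝ (Fin d), c + ∑ j, x j * a j ≠ 0 := by
  let f : EuclideanSpace ℝ (Fin d) →ᵃ[ℝ] ℝ := (∑ j : Fin d, a j • (EuclideanSpace.proj j :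
    EuclideanSpace ℝ (Fin d) →L[ℝ] ℝ).toLinearMap).toAffineMap + AffineMap.const ℝ _ c
  have hf (x) : f x = c + ∑ j, x j * a j := by
    rw [add_comm]
    simp only [mul_comm (x _)]
    simp [f]
  let S : AffineSubspace ℝ (EuclideanSpace ℝ (Fin d)) := (AffineSubspace.mk' (0 : ℝ) ⊥).comap f
  have hS (x) : x ∈ S ↔ c + ∑ j, x j * a j = 0 := by
    simp [S, hf, AffineSubspace.mem_mk']
  have hST : S ≠ ⊤ := fun h => hy ((hS y).1 (h ▸ AffineSubspace.mem_top ℝ _ y))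
  filter_upwards [measure_eq_zero_iff_ae_notMem.1 (Measure.addHaar_affineSubspace volume S hST)]
    with x hx h
  exact hx ((hS x).2 h)

lemma ae_last_ne_zero (n : ℕ) :
    ∀ᵐ x : EuclideanSpace ℝ (Fin (n + 1)), x (Fin.last n) ≠ 0 := by
  have := ae_affine_ne_zero (0 : ℝ) (Pi.single (Fin.last n) 1)
    (y := EuclideanSpace.single (Fin.last n) (1 : ℝ)) (by simp [Pi.single_apply])
  simpa [Pi.single_apply] using this

/-- The combination is affine and equals `a` at the vertex `X i`. It yields both nonvanishing of
single coordinates and distinctness of crossing parameters. -/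
lemma ae_bary_combo_ne_zero {d : ℕ} {X : Fin (d + 1) → EuclideanSpace ℝ (Fin d)}
    (hX : (homog X).det ≠ 0) {i j : Fin (d + 1)} (hij : i ≠ j) {a : ℝ} (ha : a ≠ 0) (b : ℝ) :
    ∀ᵐ x, bary X x i * a + bary X x j * b ≠ 0 := by
  have hform (x : EuclideanSpace ℝ (Fin d)) : bary X x i * a + bary X x j * b =
      ((homog X)⁻¹ 0 i * a + (homog X)⁻¹ 0 j * b) +
        ∑ l : Fin d, x l * ((homog X)⁻¹ l.succ i * a + (homog X)⁻¹ l.succ j * b) := by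
    rw [bary_apply, bary_apply]
    simp only [mul_add, Finset.sum_add_distrib, add_mul, Finset.sum_mul, mul_assoc]
    ring
  simp only [hform]
  refine ae_affine_ne_zero _ _ (y := X i) ?_
  rw [← hform, bary_vertex hX]
  simpa [Pi.single_apply, hij.symm] using ha

/-- Almost everywhere, the indicator of a positively oriented simplex is the alternating sum of the
signed indicators of the prisms below its facets. -/
lemma ae_indicator_simplex_eq {n : ℕ} {A : Fin (n + 2) → EuclideanSpace ℝ (Fin (n + 1))}
    (hA : 0 < (homog A).det) :
    ∀ᵐ x, (convexHull ℝ (Set.range A)).indicator (fun _ => (1 : ℝ)) x =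
      (-1 : ℝ) ^ (n + 1) * ∑ k : Fin (n + 2), (-1 : ℝ) ^ ((k : ℕ) + 1) *
        ((orient fun i => proj (face A k i) : SignType) : ℝ) * prismIndicator (face A k) x := by
  classical
  have hbary : ∀ᵐ x, ∀ k, bary A x k ≠ 0 := ae_all_iff.2 fun k => by
    obtain ⟨j, hj⟩ := exists_ne k
    simpa using ae_bary_combo_ne_zero hA.ne' hj.symm one_ne_zero 0
  have hgen : ∀ᵐ x, ∀ i j, i ≠ j → vert A i ≠ 0 → vert A j ≠ 0 →
      bary A x i * vert A j ≠ bary A x j * vert A i := by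
    simp only [ae_all_iff, eventually_imp_distrib_left]
    intro i j hij hi hj
    filter_upwards [ae_bary_combo_ne_zero hA.ne' hij hj (-vert A i)] with x hx h
    exact hx (by rw [h]; ring)
  filter_upwards [ae_last_ne_zero n, hbary, hgen] with x hx hb hg
  have key := sum_sign_hit_eq (bary A x) (vert A) (sum_vert hA.ne') (exists_vert_ne_zero hA.ne')
    hb hg (if x (Fin.last n) < 0 then 1 else 0)
  have hT : (convexHull ℝ (Set.range A)).indicator (fun _ => (1 : ℝ)) x =
      if ∀ i, 0 ≤ bary A x i then 1 else 0 := by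
    simp only [Set.indicator_apply, mem_convexHull_iff_bary hA.ne']
  rw [hT, ← neg_eq_iff_eq_neg.2 key, ← Finset.sum_neg_distrib, Finset.mul_sum]
  refine Finset.sum_congr rfl fun k _ => ?_
  have hs := sign_vert hA k
  -- A zero rate forces a zero orientation, so the dummy height of a vertical facet never matters.
  by_cases hk : vert A k = 0
  · rw [hk, sign_zero, SignType.coe_zero] at hs
    have ho : ((orient fun i => proj (face A k i) : SignType) : ℝ) = 0 :=
      (mul_eq_zero.1 hs.symm).resolve_left (pow_ne_zero _ (by norm_num))
    rw [hk, ho]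
    simp
  · rw [prismIndicator_face hA.ne' hk hx (hb k), hs]
    ring

/-! ### Averaging over balls -/

lemma measurableSet_simplex {n : ℕ} (A : Fin (n + 2) → EuclideanSpace ℝ (Fin (n + 1))) :
    MeasurableSet (convexHull ℝ (Set.range A)) :=
  ((Set.finite_range _).isClosed_convexHull ℝ).measurableSet

lemma densityRatio_simplex_eq {n : ℕ} {A : Fin (n + 2) → EuclideanSpace ℝ (Fin (n + 1))}
    (hA : 0 < (homog A).det) (x : EuclideanSpace ℝ (Fin (n + 1))) (ρ : ℝ) :
    densityRatio (convexHull ℝ (Set.range A)) x ρ =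
      (-1 : ℝ) ^ (n + 1) * ∑ k : Fin (n + 2), (-1 : ℝ) ^ ((k : ℕ) + 1) *
        ((orient fun i => proj (face A k i) : SignType) : ℝ) * prismMean (face A k) x ρ := by
  rw [densityRatio_eq_integral (measurableSet_simplex A),
    integral_congr_ae (ae_restrict_of_ae (ae_indicator_simplex_eq hA)), integral_const_mul,
    integral_finsetSum _ fun k _ => ((integrable_prismIndicator (face A k)).const_mul _).integrableOn,
    mul_div_assoc, Finset.sum_div]
  simp only [integral_const_mul, mul_div_assoc, prismMean]

end PrismSplitting

theorem mainTheorem3 (n : ℕ) (A : Fin (n + 2) → EuclideanSpace ℝ (Fin (n + 1)))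
    (hA : PrismSplitting.orient A = 1) (x : EuclideanSpace ℝ (Fin (n + 1))) :
    Tendsto (PrismSplitting.densityRatio (convexHull ℝ (Set.range A)) x) (𝓝[>] (0 : ℝ))
        (𝓝 (PrismSplitting.chi (convexHull ℝ (Set.range A)) x)) ∧
      (∀ k : Fin (n + 2), ¬ PrismSplitting.IsVertical (PrismSplitting.face A k) →
        Integrable (PrismSplitting.prismIndicator (PrismSplitting.face A k)) volume ∧
        Tendsto (PrismSplitting.prismMean (PrismSplitting.face A k) x) (𝓝[>] (0 : ℝ))
          (𝓝 (PrismSplitting.prismChi (PrismSplitting.face A k) x))) ∧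
      PrismSplitting.chi (convexHull ℝ (Set.range A)) x =
        (-1 : ℝ) ^ (n + 1) * ∑ k : Fin (n + 2), (-1 : ℝ) ^ ((k : ℕ) + 1) *
          ((PrismSplitting.orient fun i => PrismSplitting.proj (PrismSplitting.face A k i) :
            SignType) : ℝ) *
          PrismSplitting.prismChi (PrismSplitting.face A k) x := by
  open PrismSplitting in
  have hdet : 0 < (homog A).det := by
    rwa [orient_eq_sign_det_homog, sign_eq_one_iff] at hA
  have hT := tendsto_densityRatio_chi (convex_convexHull ℝ (Set.range A)) x
  refine ⟨hT, fun k hk => ⟨integrable_prismIndicator _, tendsto_prismMean _ x hk⟩, ?_⟩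
  refine tendsto_nhds_unique hT ?_
  rw [funext (densityRatio_simplex_eq hdet x)]
  refine (tendsto_finsetSum _ fun k _ => ?_).const_mul _
  -- A zero coefficient removes the term; a nonzero one makes the facet non-vertical, so its mean
  -- converges.
  by_cases ho : orient (fun i => proj (face A k i)) = 0
  · simp [ho]
  · refine (tendsto_prismMean _ x (not_isVertical ?_)).const_mul _
    rwa [orient_eq_sign_det_homog, sign_eq_zero_iff] at ho
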